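/- Let $\Gamma\subset \mathrm{PSL}_2(\mathbb R)$ be a Fuchsian group of the first kind, acting on the upper half plane $\mathbb H$ with $\Gamma\backslash\mathbb H$ of finite volume for $d\mu(z)=y^{-2}\,dx\,dy$ (that is, a discrete subgroup of finite covolume; it may or may not have cusps), and let $k\ge 4$ be an even integer. For $\gamma=\pm\begin{pmatrix}a&b\\c&d\end{pmatrix}\in\mathrm{PSL}_2(\mathbb R)$ put $(f|_k\gamma)(z)=f(\gamma z)(cz+d)^{-k}$. Let $S_k(\Gamma)$ be the space of holomorphic cusp forms of weight $k$ for $\Gamma$, i.e. of the holomorphic functions $f$ on $\mathbb H$ with $f|_k\gamma=f$ for all $\gamma\in\Gamma$ that decay rapidly at each cusp of $\Gamma$: if $\sigma\in \mathrm{SL}_2(\mathbb R)$ maps $\infty$ to the cusp, then $(f|_k\sigma)(x+iy)=O(e^{-ay})$ as $y\to\infty$, uniformly in $x$, for some $a>0$. Let $\Gamma_0$ be a subgroup of $\Gamma$ and $\phi$ a holomorphic function on $\mathbb H$ satisfying $\phi|_k\gamma=\phi$ for all $\gamma\in\Gamma_0$ and $$\int_{\Gamma_0\backslash\mathbb H}|\phi(z)|\,y^{k/2}\,d\mu(z)<\infty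 .$$ Then the relative Poincaré series $$P[\phi](z)=\sum_{\gamma\in\Gamma_0\backslash\Gamma}(\phi|_k\gamma)(z)$$ converges absolutely and uniformly on compact subsets of $\mathbb H$ to an element of $S_k(\Gamma)$. -/

import Mathlib

open UpperHalfPlane MeasureTheory
open scoped MatrixGroups ModularForm Manifold

noncomputable section

/-- The center of `SL(2, ℝ)` consists of `± 1`. -/
theorem eq_or_eq_neg_of_mk_eq {g h : SL(2, ℝ)} (H : (g : PSL(2, ℝ)) = (h : PSL(2, ℝ))) :
    h = g ∨ h = -g := by
  rw [QuotientGroup.eq, Matrix.SpecialLinearGroup.mem_center_iff] at H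
  obtain ⟨r, hr, hs⟩ := H
  have hr' : r = 1 ∨ r = -1 := by
    rw [Fintype.card_fin] at hr
    simpa using hr
  rcases hr' with rfl | rfl
  · left
    have h1 : g⁻¹ * h = 1 := by
      apply Subtype.ext
      rw [← hs]
      simp
    exact (inv_mul_eq_one.mp h1).symm
  · right
    have h1 : g⁻¹ * h = -1 := by
      apply Subtype.ext
      rw [← hs]
      ext i j
      fin_cases i <;> fin_cases j <;> simp
    rw [inv_mul_eq_iff_eq_mul.mp h1, mul_neg, mul_one]

/-- `SL(2, ℝ)` acts on `ℍ` through `PSL(2, ℝ)`. -/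
theorem smul_eq_smul_of_mk_eq {g h : SL(2, ℝ)} (H : (g : PSL(2, ℝ)) = (h : PSL(2, ℝ))) (z : ℍ) :
    g • z = h • z := by
  rcases eq_or_eq_neg_of_mk_eq H with rfl | rfl
  · rfl
  · change (g : GL (Fin 2) ℝ) • z = ((-g : SL(2, ℝ)) : GL (Fin 2) ℝ) • z
    have : ((-g : SL(2, ℝ)) : GL (Fin 2) ℝ) = -(g : GL (Fin 2) ℝ) := by
      ext i j; simp
    rw [this, UpperHalfPlane.neg_smul]

/-- The action of `PSL(2, ℝ)` on the upper half plane by Möbius transformations. -/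
instance pslAction : MulAction PSL(2, ℝ) ℍ where
  smul γ z := Quotient.liftOn' γ (fun g : SL(2, ℝ) => g • z)
    (fun _ _ H => smul_eq_smul_of_mk_eq (Quotient.sound' H) z)
  one_smul z := one_smul SL(2, ℝ) z
  mul_smul a b z := by
    induction a using Quotient.inductionOn'
    induction b using Quotient.inductionOn'
    exact mul_smul (α := SL(2, ℝ)) _ _ z

theorem psl_mk_smul (g : SL(2, ℝ)) (z : ℍ) : (g : PSL(2, ℝ)) • z = g • z := rfl

/-- The weight `k` slash operator `(f|_k γ)(z) = f(γ z) / j(γ, z)^k` for `γ ∈ PSL(2, ℝ)`, where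
`j(γ, z) = c z + d` is formed with a representative `(a b; c d) ∈ SL(2, ℝ)` of `γ`. For even `k`
the choice of the representative does not matter, see `pslSlash_mk`. -/
def pslSlash (k : ℤ) (f : ℍ → ℂ) (γ : PSL(2, ℝ)) : ℍ → ℂ :=
  f ∣[k] ((Quotient.out γ : SL(2, ℝ)) : GL (Fin 2) ℝ)

theorem slash_neg_of_even {k : ℤ} (hk : Even k) (f : ℍ → ℂ) (g : SL(2, ℝ)) :
    f ∣[k] ((-g : SL(2, ℝ)) : GL (Fin 2) ℝ) = f ∣[k] (g : GL (Fin 2) ℝ) := by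
  have : ((-g : SL(2, ℝ)) : GL (Fin 2) ℝ) = -(g : GL (Fin 2) ℝ) := by
    ext i j; simp
  rw [this]
  ext z
  have hd : (-(g : GL (Fin 2) ℝ)).det = (g : GL (Fin 2) ℝ).det := by
    ext; simp [Matrix.det_neg]
  simp only [ModularForm.slash_def, UpperHalfPlane.neg_smul, UpperHalfPlane.σ_neg,
    UpperHalfPlane.denom_neg, hk.neg.neg_zpow, hd]

theorem pslSlash_mk {k : ℤ} (hk : Even k) (f : ℍ → ℂ) (g : SL(2, ℝ)) :
    pslSlash k f (g : PSL(2, ℝ)) = f ∣[k] (g : GL (Fin 2) ℝ) := by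
  have H : (g : PSL(2, ℝ)) = ((Quotient.out (g : PSL(2, ℝ)) : SL(2, ℝ)) : PSL(2, ℝ)) :=
    (Quotient.out_eq _).symm
  unfold pslSlash
  rcases eq_or_eq_neg_of_mk_eq H with h | h
  · rw [h]
  · rw [h, slash_neg_of_even hk]

theorem pslSlash_mk_apply {k : ℤ} (hk : Even k) (f : ℍ → ℂ) (g : SL(2, ℝ)) (z : ℍ) :
    pslSlash k f (g : PSL(2, ℝ)) z = f (g • z) / ((g 1 0 : ℂ) * z + g 1 1) ^ k := by
  rw [pslSlash_mk hk, ModularForm.slash_def]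
  simp [UpperHalfPlane.σ, UpperHalfPlane.denom, div_eq_mul_inv]
  left
  rfl

theorem pslSlash_mul {k : ℤ} (hk : Even k) (f : ℍ → ℂ) (a b : PSL(2, ℝ)) :
    pslSlash k f (a * b) = pslSlash k (pslSlash k f a) b := by
  obtain ⟨a, rfl⟩ := QuotientGroup.mk_surjective a
  obtain ⟨b, rfl⟩ := QuotientGroup.mk_surjective b
  rw [← QuotientGroup.mk_mul, pslSlash_mk hk, pslSlash_mk hk, pslSlash_mk hk, map_mul,
    SlashAction.slash_mul]

/-- The set `Γ₀ \ Γ` of right cosets `Γ₀ γ` of `Γ₀` in `Γ` (for `Γ₀ ≤ Γ`). -/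
abbrev RightCosets (Γ₀ Γ : Subgroup PSL(2, ℝ)) : Type :=
  Quotient (QuotientGroup.rightRel (Γ₀.subgroupOf Γ))

/-- The term `φ|_k γ` of the relative Poincaré series that belongs to the coset `q = Γ₀ γ`. When
`φ|_k γ = φ` on `Γ₀` it does not depend on the representative `γ`, see `relPoincareTerm_mk`. -/
def relPoincareTerm (k : ℤ) (φ : ℍ → ℂ) (Γ₀ Γ : Subgroup PSL(2, ℝ)) (q : RightCosets Γ₀ Γ) :
    ℍ → ℂ :=
  pslSlash k φ (Quotient.out q : Γ)

theorem relPoincareTerm_mk {k : ℤ} (hk : Even k) {φ : ℍ → ℂ} {Γ₀ Γ : Subgroup PSL(2, ℝ)}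
    (hφ : ∀ γ ∈ Γ₀, pslSlash k φ γ = φ) (γ : Γ) :
    relPoincareTerm k φ Γ₀ Γ (Quotient.mk _ γ) = pslSlash k φ γ := by
  have H := Quotient.mk_out (s := QuotientGroup.rightRel (Γ₀.subgroupOf Γ)) γ
  have H' := (QuotientGroup.rightRel_apply.mp H)
  rw [Subgroup.mem_subgroupOf] at H'
  unfold relPoincareTerm
  set δ : Γ := Quotient.out (Quotient.mk (QuotientGroup.rightRel (Γ₀.subgroupOf Γ)) γ)
  have e : (γ : PSL(2, ℝ)) = ((γ * δ⁻¹ : Γ) : PSL(2, ℝ)) * (δ : PSL(2, ℝ)) := by simp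
  rw [e, pslSlash_mul hk, hφ _ H']

/-- The relative Poincaré series `P[φ](z) = ∑_{γ ∈ Γ₀ \ Γ} (φ|_k γ)(z)`. -/
def relPoincare (k : ℤ) (φ : ℍ → ℂ) (Γ₀ Γ : Subgroup PSL(2, ℝ)) (z : ℍ) : ℂ :=
  ∑' q : RightCosets Γ₀ Γ, relPoincareTerm k φ Γ₀ Γ q z

/-- The preimage of `Γ ≤ PSL(2, ℝ)` in `SL(2, ℝ)`, as a group of invertible real matrices. -/
def matrixLift (Γ : Subgroup PSL(2, ℝ)) : Subgroup (GL (Fin 2) ℝ) :=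
  (Γ.comap (QuotientGroup.mk' (Subgroup.center SL(2, ℝ)))).map
    (Matrix.SpecialLinearGroup.toGL : SL(2, ℝ) →* GL (Fin 2) ℝ)

/-- `f` decays rapidly at the cusp `c`: for every `σ ∈ SL(2, ℝ)` with `σ ∞ = c` there is `a > 0`
such that `(f|_k σ)(x + i y) = O(exp (- a y))` as `y → ∞`, uniformly in `x`. -/
def DecaysRapidlyAt (k : ℤ) (f : ℍ → ℂ) (c : OnePoint ℝ) : Prop :=
  ∀ σ : SL(2, ℝ), (σ : GL (Fin 2) ℝ) • OnePoint.infty = c →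
    ∃ a : ℝ, 0 < a ∧
      (f ∣[k] (σ : GL (Fin 2) ℝ)) =O[atImInfty] fun z : ℍ => Real.exp (-a * z.im)

end

/-! Everything follows from one estimate. The size `petNorm`, that is `|f| y^(k/2)`, turns the slash
operator into translation (`petNorm_slash`). For holomorphic `f` its value at `z` is at most a
constant, depending only on `k`, times its integral over `halfDisc z`
(`petNorm_le_setLIntegral_halfDisc`). Applying this to every term `φ|_k γ` and unfolding
(`tsum_setLIntegral_smul_le`) bounds the sum of the sizes at `z` by a constant times `N ∫_D |φ|
y^(k/2) dμ`, where `N` bounds how often a `Γ`-orbit, counted with stabilizers, meets the disc.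

On a compact set one finite `N` serves all discs, by proper discontinuity. The Weierstrass M-test
then gives convergence and holomorphy, and right multiplication permutes the cosets, which gives
invariance.

At a cusp moved to `∞`, the group contains a translation. By Shimizu's lemma
(`eq_zero_of_abs_mul_lt_one`) only elements `±(1 b; 0 1)` can map one point of a high disc to
another, so `N = O(y)` (`exists_encard_halfDisc_le`). Hence `y^(k/2) |P[φ]|_k σ| = O(y)`, and `k ≥
4` forces the function to tend to `0`. Being periodic and holomorphic, it then decays exponentially.
-/

/-! ### Invariant measure and unfolding -/

instance : MeasurableConstSMul PSL(2, ℝ) ℍ where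
  measurable_const_smul γ := by
    obtain ⟨g, rfl⟩ := QuotientGroup.mk_surjective γ
    exact (continuous_const_smul (T := ℍ) g).measurable

instance : SMulInvariantMeasure PSL(2, ℝ) ℍ volume where
  measure_preimage_smul γ s hs := by
    obtain ⟨g, rfl⟩ := QuotientGroup.mk_surjective γ
    exact measure_preimage_smul (μ := (volume : Measure ℍ)) (g : GL (Fin 2) ℝ) s

/-- Unfolding: if every orbit of `Γ` meets `A` at most `N` times, then the integrals over `A` of
the translates of a `Γ₀`-invariant function `h` by `Γ₀ \ Γ` add up to at most `N` times the
integral of `h` over `Γ₀ \ X`. -/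
theorem tsum_setLIntegral_smul_le {G X : Type*} [Group G] [MulAction G X] [MeasurableSpace X]
    {μ : Measure X} [MeasurableConstSMul G X] [SMulInvariantMeasure G X μ]
    {Γ Γ₀ : Subgroup G} [Countable Γ₀] [Countable Γ] (hΓ₀ : Γ₀ ≤ Γ)
    {D : Set X} (hD : IsFundamentalDomain Γ₀ D μ) {h : X → ENNReal} (hm : Measurable h)
    (hinv : ∀ γ ∈ Γ₀, ∀ x, h (γ • x) = h x) {A : Set X} (hA : MeasurableSet A) {N : ENNReal}
    (hN : ∀ x, (({γ : G | γ ∈ Γ ∧ γ • x ∈ A}.encard : ENat) : ENNReal) ≤ N) :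
    ∑' q : Quotient (QuotientGroup.rightRel (Γ₀.subgroupOf Γ)),
      ∫⁻ x in A, h ((Quotient.out q : Γ) • x) ∂μ ≤ N * ∫⁻ x in D, h x ∂μ := by
  set F : Γ → ENNReal := fun γ => ∫⁻ x in D, A.indicator 1 (γ • x) * h x ∂μ with hF
  have hind : ∀ γ : Γ, Measurable fun x : X => A.indicator (1 : X → ENNReal) (γ • x) := fun γ =>
    (measurable_one.indicator hA).comp (measurable_const_smul (γ : G))
  have step (q : Quotient (QuotientGroup.rightRel (Γ₀.subgroupOf Γ))) :
      ∫⁻ x in A, h ((Quotient.out q : Γ) • x) ∂μ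
        = ∑' g : Γ₀, F ((Subgroup.inclusion hΓ₀ g * Quotient.out q)⁻¹) := by
    set γ : Γ := Quotient.out q
    have e1 : ∫⁻ x in A, h (γ • x) ∂μ =
        ∫⁻ x, A.indicator 1 (γ⁻¹ • x) * h x ∂μ := by
      rw [← (measurePreserving_smul (γ : G) μ).lintegral_comp (by
        exact (hind γ⁻¹).mul hm), ← lintegral_indicator hA]
      refine lintegral_congr fun x => ?_
      have : γ⁻¹ • (γ : G) • x = x := inv_smul_smul γ x
      rw [this]
      by_cases hx : x ∈ A <;> simp [hx]
      rfl
    rw [e1, hD.lintegral_eq_tsum']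
    refine tsum_congr fun g => ?_
    refine lintegral_congr fun x => ?_
    have h1 : h (g⁻¹ • x) = h x := hinv _ (inv_mem g.2) x
    rw [h1]
    congr 2
    simp only [mul_inv_rev, mul_smul]
    rfl
  simp_rw [step]
  rw [← ENNReal.tsum_prod (f := fun q (g : Γ₀) => F ((Subgroup.inclusion hΓ₀ g * Quotient.out q)⁻¹))]
  -- An element of `Γ` is a product of an element of `Γ₀` and a coset representative in only one
  -- way, so the double sum repeats no term of the sum over `Γ`; for an upper bound this suffices.
  have hinj : Function.Injective
      fun p : Quotient (QuotientGroup.rightRel (Γ₀.subgroupOf Γ)) × Γ₀ =>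
        (Subgroup.inclusion hΓ₀ p.2 * Quotient.out p.1)⁻¹ := by
    rintro ⟨q, g⟩ ⟨q', g'⟩ H
    have H := inv_injective H
    simp only at H
    have hq : q = q' := by
      rw [← Quotient.out_eq q, ← Quotient.out_eq q']
      apply Quotient.sound
      refine QuotientGroup.rightRel_apply.mpr ?_
      have : Quotient.out q' * (Quotient.out q)⁻¹
          = (Subgroup.inclusion hΓ₀ g')⁻¹ * Subgroup.inclusion hΓ₀ g := by
        rw [eq_inv_mul_iff_mul_eq, ← mul_assoc, ← H, mul_inv_cancel_right]
      rw [this, Subgroup.mem_subgroupOf]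
      exact mul_mem (inv_mem g'.2) g.2
    subst hq
    have := Subgroup.inclusion_injective hΓ₀ (mul_right_cancel H)
    rw [this]
  refine (ENNReal.tsum_comp_le_tsum_of_injective hinj F).trans ?_
  simp only [hF]
  rw [← lintegral_tsum (f := fun (γ : Γ) x => A.indicator 1 (γ • x) * h x)
    fun γ => ((hind γ).mul hm).aemeasurable, ← lintegral_const_mul _ hm]
  refine lintegral_mono fun x => ?_
  rw [ENNReal.tsum_mul_right]
  gcongr
  -- The remaining sum of indicators counts the `γ ∈ Γ` with `γ • x ∈ A`.
  refine le_trans (le_of_eq ?_) (hN x)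
  have e2 : {γ : G | γ ∈ Γ ∧ γ • x ∈ A} = Subtype.val '' {γ : Γ | γ • x ∈ A} := by
    ext γ
    constructor
    · rintro ⟨h1, h2⟩
      exact ⟨⟨γ, h1⟩, h2, rfl⟩
    · rintro ⟨γ, h2, rfl⟩
      exact ⟨γ.2, h2⟩
  rw [e2, Subtype.val_injective.encard_image, ← ENNReal.tsum_set_one, tsum_subtype _ (fun _ => 1)]
  rfl

/-! ### Mean value inequality on discs -/

theorem two_pi_mul_enorm_le_lintegral_circle {f : ℂ → ℂ} {c : ℂ} {r : ℝ}
    (hf : DiffContOnCl ℂ f (Metric.ball c |r|)) :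
    ENNReal.ofReal (2 * Real.pi) * ‖f c‖ₑ ≤
      ∫⁻ θ in Set.Ioo (-Real.pi) Real.pi, ‖f (circleMap c r θ)‖ₑ := by
  have h1 := hf.circleAverage
  rw [Real.circleAverage_def, inv_smul_eq_iff₀ (by positivity)] at h1
  have hper : Function.Periodic (fun θ => f (circleMap c r θ)) (2 * Real.pi) := fun θ => by
    simp only [periodic_circleMap c r θ]
  have h2 := hper.intervalIntegral_add_eq 0 (-Real.pi)
  rw [zero_add, h1, show -Real.pi + 2 * Real.pi = Real.pi by ring,
    intervalIntegral.integral_of_le (by linarith [Real.pi_pos])] at h2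
  have h3 : ‖(2 * Real.pi) • f c‖ₑ = ENNReal.ofReal (2 * Real.pi) * ‖f c‖ₑ := by
    rw [enorm_smul, Real.enorm_of_nonneg (by positivity)]
  rw [← h3, h2, setLIntegral_congr Ioo_ae_eq_Ioc]
  exact enorm_integral_le_lintegral_enorm _

/-- The area sub-mean value property of holomorphic functions. -/
theorem enorm_le_lintegral_ball {f : ℂ → ℂ} {c : ℂ} {R : ℝ} (hR : 0 ≤ R)
    (hf : DifferentiableOn ℂ f (Metric.ball c R)) :
    ENNReal.ofReal (Real.pi * R ^ 2) * ‖f c‖ₑ ≤ ∫⁻ w in Metric.ball c R, ‖f w‖ₑ := by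
  rw [← lintegral_indicator measurableSet_ball, ← lintegral_add_left_eq_self _ c,
    ← Complex.lintegral_comp_polarCoord_symm]
  have hsub : Set.Ioo 0 R ×ˢ Set.Ioo (-Real.pi) Real.pi ⊆ Complex.polarCoord.target := by
    rw [Complex.polarCoord_target]
    exact Set.prod_mono Set.Ioo_subset_Ioi_self subset_rfl
  refine le_trans ?_ (lintegral_mono_set hsub)
  have hcirc : ∀ p : ℝ × ℝ, c + Complex.polarCoord.symm p = circleMap c p.1 p.2 := fun p => by
    rw [Complex.polarCoord_symm_apply, circleMap, Complex.exp_mul_I]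
    push_cast
    ring
  have hmem : ∀ r ∈ Set.Ioo 0 R, ∀ θ, circleMap c r θ ∈ Metric.ball c R := fun r hr θ => by
    rw [Metric.mem_ball, dist_eq_norm, circleMap_sub_center, norm_circleMap_zero, abs_of_pos hr.1]
    exact hr.2
  have e1 : ∫⁻ p in Set.Ioo 0 R ×ˢ Set.Ioo (-Real.pi) Real.pi, ENNReal.ofReal p.1 •
      (Metric.ball c R).indicator (fun w => ‖f w‖ₑ) (c + Complex.polarCoord.symm p)
      = ∫⁻ p in Set.Ioo 0 R ×ˢ Set.Ioo (-Real.pi) Real.pi, ENNReal.ofReal p.1 *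
        ‖f (circleMap c p.1 p.2)‖ₑ := by
    refine setLIntegral_congr_fun (measurableSet_Ioo.prod measurableSet_Ioo) fun p hp => ?_
    simp only [hcirc, Set.indicator_of_mem (hmem _ hp.1 _), smul_eq_mul]
  have hcont : ContinuousOn (fun p : ℝ × ℝ => f (circleMap c p.1 p.2))
      (Set.Ioo 0 R ×ˢ Set.Ioo (-Real.pi) Real.pi) := by
    refine hf.continuousOn.comp ?_ fun p hp => hmem _ hp.1 _
    unfold circleMap
    fun_prop
  rw [e1, Measure.volume_eq_prod, ← Measure.prod_restrict, lintegral_prod]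
  -- The inequality on circles is integrated against `r dr`.
  · have e2 : ∀ r ∈ Set.Ioo 0 R, ENNReal.ofReal r * (ENNReal.ofReal (2 * Real.pi) * ‖f c‖ₑ) ≤
        ∫⁻ θ in Set.Ioo (-Real.pi) Real.pi, ENNReal.ofReal r * ‖f (circleMap c r θ)‖ₑ := by
      intro r hr
      rw [lintegral_const_mul' _ _ ENNReal.ofReal_ne_top]
      gcongr
      refine two_pi_mul_enorm_le_lintegral_circle (DifferentiableOn.diffContOnCl ?_)
      refine hf.mono ?_
      refine Metric.closure_ball_subset_closedBall.trans ?_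
      rw [abs_of_pos hr.1]
      exact Metric.closedBall_subset_ball hr.2
    refine le_trans (le_of_eq ?_) (setLIntegral_mono' measurableSet_Ioo e2)
    rw [lintegral_mul_const _ (by fun_prop), ← mul_assoc]
    congr 1
    have e3 : ∫⁻ r in Set.Ioo 0 R, ENNReal.ofReal r = ENNReal.ofReal (R ^ 2 / 2) := by
      rw [← ofReal_integral_eq_lintegral_ofReal]
      · rw [← integral_Ioc_eq_integral_Ioo, ← intervalIntegral.integral_of_le hR, integral_id]
        congr 1
        ring
      · exact (continuous_id.integrableOn_Icc (a := 0) (b := R)).mono_set Set.Ioo_subset_Icc_self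
      · exact (ae_restrict_iff' measurableSet_Ioo).mpr (.of_forall fun r hr => hr.1.le)
    rw [e3, ← ENNReal.ofReal_mul (by positivity)]
    congr 1
    ring
  · rw [Measure.prod_restrict]
    refine (ENNReal.measurable_ofReal.comp measurable_fst).aemeasurable.mul ?_
    exact (hcont.aemeasurable (measurableSet_Ioo.prod measurableSet_Ioo)).enorm

/-- The Euclidean disc about `z` whose radius is half the distance of `z` to the real line. -/
def halfDisc (z : ℍ) : Set ℍ := {u | dist (u : ℂ) z < z.im / 2}

theorem isOpen_halfDisc (z : ℍ) : IsOpen (halfDisc z) :=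
  isOpen_lt (by fun_prop) continuous_const

theorem abs_im_sub_lt_of_mem_halfDisc {z u : ℍ} (h : u ∈ halfDisc z) : |u.im - z.im| < z.im / 2 :=
  lt_of_le_of_lt (by simpa [dist_eq_norm] using Complex.abs_im_le_norm ((u : ℂ) - z)) h

theorem abs_re_sub_lt_of_mem_halfDisc {z u : ℍ} (h : u ∈ halfDisc z) : |u.re - z.re| < z.im / 2 :=
  lt_of_le_of_lt (by simpa [dist_eq_norm] using Complex.abs_re_le_norm ((u : ℂ) - z)) h

theorem coe_image_halfDisc (z : ℍ) :
    UpperHalfPlane.coe '' halfDisc z = Metric.ball (z : ℂ) (z.im / 2) := by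
  ext w
  constructor
  · rintro ⟨u, hu, rfl⟩
    exact hu
  · intro hw
    have h1 : |w.im - z.im| < z.im / 2 :=
      lt_of_le_of_lt (by simpa [dist_eq_norm] using Complex.abs_im_le_norm (w - z)) hw
    have := z.im_pos
    exact ⟨⟨w, by rw [abs_lt] at h1; linarith⟩, hw, rfl⟩

theorem setLIntegral_upperHalfPlane_eq {s : Set ℍ} (hs : MeasurableSet s) {f : ℍ → ENNReal}
    (hf : Measurable f) : ∫⁻ u in s, f u = ∫⁻ w in UpperHalfPlane.coe '' s,
      ENNReal.ofReal ((w.im ^ 2)⁻¹) * f (ofComplex w) := by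
  have hmeas : Measurable fun z : ℍ => ((1 / NNReal.mk z.im z.im_pos.le : NNReal) ^ 2) := by
    refine (Continuous.measurable ?_)
    refine .pow (.div₀ continuous_const ?_ ?_) _
    · exact continuous_im.subtype_mk _
    · exact fun x ↦ NNReal.ne_iff.mp x.im_ne_zero
  rw [volume_def, restrict_withDensity hs, lintegral_withDensity_eq_lintegral_mul _ (by fun_prop) hf]
  have hmp : MeasurePreserving UpperHalfPlane.coe (volume.comap UpperHalfPlane.coe)
      (volume.restrict (.range UpperHalfPlane.coe)) :=
    ⟨measurable_coe, by rw [measurableEmbedding_coe.map_comap]⟩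
  rw [← Set.inter_eq_self_of_subset_left (Set.image_subset_range UpperHalfPlane.coe s),
    ← Measure.restrict_restrict' measurableEmbedding_coe.measurableSet_range,
    ← hmp.setLIntegral_comp_emb measurableEmbedding_coe]
  refine setLIntegral_congr_fun hs fun u _ => ?_
  simp only [Pi.mul_apply, ofComplex_apply]
  congr 1
  rw [ENNReal.ofReal, ENNReal.coe_inj]
  ext
  have := u.im_pos
  simp only [coe_im, one_div, inv_pow, NNReal.coe_inv, NNReal.coe_pow, NNReal.coe_mk]
  rw [Real.coe_toNNReal _ (by positivity)]

/-- The invariant size `|f(z)| y ^ (k / 2)` of a function of weight `k`. -/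
noncomputable def petNorm (k : ℤ) (f : ℍ → ℂ) (z : ℍ) : ENNReal :=
  ENNReal.ofReal (‖f z‖ * z.im ^ ((k : ℝ) / 2))

theorem measurable_petNorm {k : ℤ} {f : ℍ → ℂ} (hf : Continuous f) : Measurable (petNorm k f) := by
  refine ENNReal.measurable_ofReal.comp (Continuous.measurable ?_)
  exact hf.norm.mul (continuous_im.rpow_const fun z => Or.inl z.im_ne_zero)

/-- On the disc the height `v` lies between `y/2` and `3y/2`, so `v^(-2) ≥ 4/(9y²)` and `v^(k/2) ≥
(y/2)^(k/2)`. With the Euclidean area `π(y/2)²` all powers of `y` cancel and the constant is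
independent of `z`. -/
theorem petNorm_le_setLIntegral_halfDisc {k : ℤ} (hk : 0 ≤ k) {f : ℍ → ℂ}
    (hf : MDifferentiable 𝓘(ℂ) 𝓘(ℂ) f) (z : ℍ) :
    petNorm k f z ≤ ENNReal.ofReal (9 / Real.pi * 2 ^ ((k : ℝ) / 2)) *
      ∫⁻ u in halfDisc z, petNorm k f u := by
  have hz := z.im_pos
  have hpi := Real.pi_pos
  have hk' : (0 : ℝ) ≤ (k : ℝ) / 2 := by positivity
  rw [setLIntegral_upperHalfPlane_eq (isOpen_halfDisc z).measurableSet
    (measurable_petNorm hf.continuous), coe_image_halfDisc]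
  have hball : ∀ w ∈ Metric.ball (z : ℂ) (z.im / 2), z.im / 2 < w.im ∧ w.im < 3 * z.im / 2 := by
    intro w hw
    have h1 : |w.im - z.im| < z.im / 2 :=
      lt_of_le_of_lt (by simpa [dist_eq_norm] using Complex.abs_im_le_norm (w - z)) hw
    rw [abs_lt] at h1
    constructor <;> linarith
  have hd : DifferentiableOn ℂ (f ∘ ofComplex) (Metric.ball (z : ℂ) (z.im / 2)) :=
    (UpperHalfPlane.mdifferentiable_iff.mp hf).mono fun w hw => by
      have := hball w hw
      simp only [Set.mem_ofPred_eq]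
      linarith
  have h1 := enorm_le_lintegral_ball (by positivity) hd
  have h2 : ENNReal.ofReal (4 / (9 * z.im ^ 2) * (z.im / 2) ^ ((k : ℝ) / 2)) *
      ∫⁻ w in Metric.ball (z : ℂ) (z.im / 2), ‖(f ∘ ofComplex) w‖ₑ ≤
      ∫⁻ w in Metric.ball (z : ℂ) (z.im / 2), ENNReal.ofReal ((w.im ^ 2)⁻¹) *
        petNorm k f (ofComplex w) := by
    rw [← lintegral_const_mul' _ _ ENNReal.ofReal_ne_top]
    refine setLIntegral_mono' measurableSet_ball fun w hw => ?_
    obtain ⟨hw1, hw2⟩ := hball w hw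
    have hw0 : 0 < w.im := by linarith
    rw [petNorm, ← ofReal_norm, ← ENNReal.ofReal_mul (by positivity),
      ← ENNReal.ofReal_mul (by positivity)]
    apply ENNReal.ofReal_le_ofReal
    have e : (ofComplex w).im = w.im := by rw [ofComplex_apply_of_im_pos hw0]; rfl
    rw [e, Function.comp_apply, mul_assoc, mul_comm ‖_‖]
    gcongr
    rw [show 4 / (9 * z.im ^ 2) = ((3 * z.im / 2) ^ 2)⁻¹ by field_simp; norm_num]
    gcongr
  calc petNorm k f z = ENNReal.ofReal (9 / Real.pi * 2 ^ ((k : ℝ) / 2)) *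
        (ENNReal.ofReal (4 / (9 * z.im ^ 2) * (z.im / 2) ^ ((k : ℝ) / 2)) *
        (ENNReal.ofReal (Real.pi * (z.im / 2) ^ 2) * ‖(f ∘ ofComplex) z‖ₑ)) := by
        rw [petNorm, ← ofReal_norm, ← ENNReal.ofReal_mul (by positivity),
          ← ENNReal.ofReal_mul (by positivity), ← ENNReal.ofReal_mul (by positivity)]
        congr 1
        rw [Function.comp_apply, ofComplex_apply, Real.div_rpow hz.le (by norm_num)]
        field_simp
        norm_num
    _ ≤ _ := by
        gcongr
        exact (mul_le_mul_right h1 _).trans h2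

/-! ### Discrete groups: lifts to `SL(2, ℝ)` and orbit counts -/

section

open Filter Topology

/-- The preimage in `SL(2, ℝ)` of the conjugate `σ⁻¹ Γ σ` of `Γ ≤ PSL(2, ℝ)`. -/
def conjLift (Γ : Subgroup PSL(2, ℝ)) (σ : SL(2, ℝ)) : Subgroup SL(2, ℝ) :=
  Γ.comap ((QuotientGroup.mk' (Subgroup.center SL(2, ℝ))).comp (MulAut.conj σ).toMonoidHom)

theorem mem_conjLift {Γ : Subgroup PSL(2, ℝ)} {σ g : SL(2, ℝ)} :
    g ∈ conjLift Γ σ ↔ ((σ * g * σ⁻¹ : SL(2, ℝ)) : PSL(2, ℝ)) ∈ Γ := Iff.rfl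

theorem psl_mk_neg (g : SL(2, ℝ)) : ((-g : SL(2, ℝ)) : PSL(2, ℝ)) = (g : PSL(2, ℝ)) := by
  refine (QuotientGroup.eq.mpr ?_).symm
  rw [mul_neg, inv_mul_cancel, Matrix.SpecialLinearGroup.mem_center_iff]
  exact ⟨-1, by simp, by ext i j; fin_cases i <;> fin_cases j <;> simp⟩

theorem neg_mem_conjLift {Γ : Subgroup PSL(2, ℝ)} {σ g : SL(2, ℝ)} (h : g ∈ conjLift Γ σ) :
    -g ∈ conjLift Γ σ := by
  rw [mem_conjLift] at h ⊢
  rwa [mul_neg, neg_mul, psl_mk_neg]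

instance discreteTopology_conjLift (Γ : Subgroup PSL(2, ℝ)) [DiscreteTopology Γ] (σ : SL(2, ℝ)) :
    DiscreteTopology (conjLift Γ σ) := by
  obtain ⟨V, hV, hV1⟩ := isOpen_induced_iff.mp (isOpen_discrete ({1} : Set Γ))
  apply discreteTopology_of_isOpen_singleton_one
  have hc : Continuous fun g : SL(2, ℝ) => ((σ * g * σ⁻¹ : SL(2, ℝ)) : PSL(2, ℝ)) :=
    QuotientGroup.continuous_mk.comp (by fun_prop)
  -- A neighbourhood isolating `1` in `Γ` pulls back to one isolating `±1`; this condition discards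
  -- `-1`.
  have hp : IsOpen {g : SL(2, ℝ) | 0 < g 0 0} := isOpen_lt continuous_const (by fun_prop)
  refine isOpen_induced_iff.mpr ⟨_ ∩ _, (hV.preimage hc).inter hp, ?_⟩
  ext ⟨g, hg⟩
  simp only [Set.mem_preimage, Set.mem_inter_iff, Set.mem_ofPred_eq, Set.mem_singleton_iff]
  have key : ((σ * g * σ⁻¹ : SL(2, ℝ)) : PSL(2, ℝ)) ∈ V ↔
      ((σ * g * σ⁻¹ : SL(2, ℝ)) : PSL(2, ℝ)) = 1 := by
    have := Set.ext_iff.mp hV1 ⟨_, mem_conjLift.mp hg⟩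
    simpa [Subtype.ext_iff] using this
  rw [key, Subtype.ext_iff]
  constructor
  · rintro ⟨h1, h2⟩
    rcases eq_or_eq_neg_of_mk_eq (g := 1) (h := σ * g * σ⁻¹) (by rw [h1]; rfl) with h | h
    · simpa [mul_inv_eq_one] using h
    · rw [mul_inv_eq_iff_eq_mul] at h
      have : g = -1 := by
        have h3 := congrArg (σ⁻¹ * ·) h
        simpa using h3
      rw [this] at h2
      exfalso
      simp at h2
      linarith
  · rintro h
    have h : g = 1 := h
    subst h
    simp

theorem psl_countable_of_discrete (Γ : Subgroup PSL(2, ℝ)) [DiscreteTopology Γ] : Countable Γ := by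
  have : SecondCountableTopology (Matrix (Fin 2) (Fin 2) ℝ) :=
    inferInstanceAs (SecondCountableTopology (Fin 2 → Fin 2 → ℝ))
  have : SecondCountableTopology SL(2, ℝ) :=
    Matrix.SpecialLinearGroup.isClosedEmbedding_val.isEmbedding.secondCountableTopology
  have : Countable (conjLift Γ 1) := TopologicalSpace.separableSpace_iff_countable.mp inferInstance
  refine Function.Surjective.countable (f := fun g : conjLift Γ 1 =>
    (⟨((g : SL(2, ℝ)) : PSL(2, ℝ)), by simpa using mem_conjLift.mp g.2⟩ : Γ)) ?_
  rintro ⟨γ, hγ⟩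
  obtain ⟨g, rfl⟩ := QuotientGroup.mk_surjective γ
  exact ⟨⟨g, mem_conjLift.mpr (by simpa using hγ)⟩, rfl⟩

/-- Moves counting at the cusp `σ ∞` to the cusp `∞` of the conjugate group. Each `γ` has two lifts
`±g`, hence only an inequality. -/
theorem encard_psl_le_encard_conjLift (Γ : Subgroup PSL(2, ℝ)) (σ : SL(2, ℝ)) (A : Set ℍ) (z : ℍ) :
    {γ : PSL(2, ℝ) | γ ∈ Γ ∧ γ • z ∈ (σ⁻¹ • ·) ⁻¹' A}.encard ≤
      {g : SL(2, ℝ) | g ∈ conjLift Γ σ ∧ g • (σ⁻¹ • z) ∈ A}.encard := by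
  refine (Set.encard_le_encard ?_).trans
    (Set.encard_image_le (fun g : SL(2, ℝ) => ((σ * g * σ⁻¹ : SL(2, ℝ)) : PSL(2, ℝ))) _)
  rintro γ ⟨h1, h2⟩
  obtain ⟨g, rfl⟩ := QuotientGroup.mk_surjective γ
  have e : σ * (σ⁻¹ * g * σ) * σ⁻¹ = g := by group
  refine ⟨σ⁻¹ * g * σ, ⟨?_, ?_⟩, ?_⟩
  · rw [mem_conjLift, e]; exact h1
  · rw [mul_smul, smul_inv_smul, mul_smul]
    exact h2
  · simp only [e]

/-- If `g₀ • z ∈ K`, then `g ↦ g * g₀⁻¹` injects the counted set into the finite set of elements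
carrying some point of `K` into `K`, which does not depend on `z`. -/
theorem exists_encard_le_of_isCompact (Λ : Subgroup SL(2, ℝ)) [DiscreteTopology Λ] {K : Set ℍ}
    (hK : IsCompact K) :
    ∃ N : ℕ, ∀ z : ℍ, {g : SL(2, ℝ) | g ∈ Λ ∧ g • z ∈ K}.encard ≤ N := by
  have hfin := Λ.properlyDiscontinuousSMul_iff.mp
    (inferInstance : ProperlyDiscontinuousSMul Λ ℍ) hK hK
  refine ⟨hfin.toFinset.card, fun z => ?_⟩
  rcases Set.eq_empty_or_nonempty {g : SL(2, ℝ) | g ∈ Λ ∧ g • z ∈ K} with h | ⟨g₀, h₀, h₀K⟩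
  · simp [h]
  rw [← Set.Finite.encard_eq_coe_toFinset_card hfin,
    ← (mul_left_injective g₀⁻¹).encard_image {g : SL(2, ℝ) | g ∈ Λ ∧ g • z ∈ K}]
  refine Set.encard_le_encard ?_
  rintro _ ⟨g, ⟨hg, hgK⟩, rfl⟩
  refine ⟨mul_mem hg (inv_mem h₀), ?_⟩
  refine ⟨g • z, ⟨g₀ • z, h₀K, ?_⟩, hgK⟩
  simp [mul_smul]

/-! ### Shimizu's lemma and orbit counts near a cusp -/

/-- The unipotent matrix `(1 x; 0 1)`. -/
def upperUnipotent (x : ℝ) : SL(2, ℝ) := ⟨!![1, x; 0, 1], by simp⟩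

@[simp] theorem coe_upperUnipotent (x : ℝ) :
    (upperUnipotent x : Matrix (Fin 2) (Fin 2) ℝ) = !![1, x; 0, 1] := rfl

theorem conj_upperUnipotent (g : SL(2, ℝ)) (h : ℝ) :
    ((g * upperUnipotent h * g⁻¹ : SL(2, ℝ)) : Matrix (Fin 2) (Fin 2) ℝ) =
      !![1 - g 0 0 * g 1 0 * h, g 0 0 ^ 2 * h; -(g 1 0 ^ 2 * h), 1 + g 0 0 * g 1 0 * h] := by
  have hdet := Matrix.det_fin_two g.1
  rw [g.2] at hdet
  simp only [Matrix.SpecialLinearGroup.coe_mul, Matrix.SpecialLinearGroup.coe_inv,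
    coe_upperUnipotent, Matrix.adjugate_fin_two]
  ext i j
  fin_cases i <;> fin_cases j <;> simp [Matrix.mul_apply, Fin.sum_univ_two]
  · linear_combination -hdet
  · ring
  · ring
  · linear_combination -hdet

theorem tendsto_specialLinearGroup_iff {ι : Type*} {l : Filter ι} {s : ι → SL(2, ℝ)}
    {g : SL(2, ℝ)} : Tendsto s l (𝓝 g) ↔ ∀ i j, Tendsto (fun n => s n i j) l (𝓝 (g i j)) := by
  refine Matrix.SpecialLinearGroup.isClosedEmbedding_val.isEmbedding.tendsto_nhds_iff.trans ?_
  exact tendsto_pi_nhds.trans (forall_congr' fun i => tendsto_pi_nhds)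

/-- Shimizu's lemma. -/
theorem eq_zero_of_abs_mul_lt_one {Λ : Subgroup SL(2, ℝ)} [DiscreteTopology Λ] {h : ℝ}
    (hh : h ≠ 0) (hT : upperUnipotent h ∈ Λ) {g : SL(2, ℝ)} (hg : g ∈ Λ) (hgh : |g 1 0 * h| < 1) :
    g 1 0 = 0 := by
  -- With `T` the translation by `h`, iterate `x ↦ x T x⁻¹`. Up to sign, `c h` is squared each time
  -- and decays geometrically, while the upper left entry grows at most linearly, so the iterates
  -- tend to `T`. By discreteness they eventually equal `T`.
  set s : ℕ → SL(2, ℝ) := fun n => (fun x => x * upperUnipotent h * x⁻¹)^[n] g with hs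
  have hs0 : s 0 = g := rfl
  have hsucc : ∀ n, s (n + 1) = s n * upperUnipotent h * (s n)⁻¹ := fun n => by
    simp only [hs, Function.iterate_succ_apply']
  have hmem : ∀ n, s n ∈ Λ := fun n => by
    induction n with
    | zero => exact hg
    | succ n ih => rw [hsucc]; exact mul_mem (mul_mem ih hT) (inv_mem ih)
  have h10 : ∀ n, s (n + 1) 1 0 = -(s n 1 0 ^ 2 * h) := fun n => by
    rw [hsucc, conj_upperUnipotent]; simp
  have h00 : ∀ n, s (n + 1) 0 0 = 1 - s n 0 0 * s n 1 0 * h := fun n => by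
    rw [hsucc, conj_upperUnipotent]; simp
  have h11 : ∀ n, s (n + 1) 1 1 = 1 + s n 0 0 * s n 1 0 * h := fun n => by
    rw [hsucc, conj_upperUnipotent]; simp
  have h01 : ∀ n, s (n + 1) 0 1 = s n 0 0 ^ 2 * h := fun n => by
    rw [hsucc, conj_upperUnipotent]; simp
  set q := |g 1 0 * h|
  have hq0 : 0 ≤ q := abs_nonneg _
  have hc : ∀ n, |s n 1 0 * h| ≤ q ^ (n + 1) := fun n => by
    induction n with
    | zero => rw [hs0, zero_add, pow_one]
    | succ n ih =>
      rw [h10, show -(s n 1 0 ^ 2 * h) * h = -((s n 1 0 * h) ^ 2) by ring, abs_neg, abs_pow]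
      calc |s n 1 0 * h| ^ 2 ≤ (q ^ (n + 1)) ^ 2 := by gcongr
        _ = q ^ ((n + 1) * 2) := by rw [pow_mul]
        _ ≤ q ^ (n + 1 + 1) := pow_le_pow_of_le_one hq0 hgh.le (by omega)
  have ha : ∀ n : ℕ, |s n 0 0| ≤ |g 0 0| + n := fun n => by
    induction n with
    | zero => simp [hs0]
    | succ n ih =>
      rw [h00, mul_assoc]
      have h1 : |s n 1 0 * h| ≤ 1 := (hc n).trans (pow_le_one₀ hq0 hgh.le)
      calc |1 - s n 0 0 * (s n 1 0 * h)| ≤ |1| + |s n 0 0 * (s n 1 0 * h)| := abs_sub _ _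
        _ ≤ 1 + (|g 0 0| + n) * 1 := by rw [abs_mul, abs_one]; gcongr
        _ = _ := by push_cast; ring
  have hlim : Tendsto (fun n => s n 0 0 * s n 1 0 * h) atTop (𝓝 0) := by
    have h1 : Tendsto (fun n : ℕ => (|g 0 0| * q) * q ^ n + q * (n * q ^ n)) atTop (𝓝 0) := by
      simpa using ((tendsto_pow_atTop_nhds_zero_of_lt_one hq0 hgh).const_mul (|g 0 0| * q)).add
        ((tendsto_self_mul_const_pow_of_lt_one hq0 hgh).const_mul q)
    refine squeeze_zero_norm (fun n => ?_) h1
    rw [mul_assoc, norm_mul, Real.norm_eq_abs, Real.norm_eq_abs]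
    calc |s n 0 0| * |s n 1 0 * h| ≤ (|g 0 0| + n) * q ^ (n + 1) := by
          gcongr
          · exact ha n
          · exact hc n
      _ = _ := by ring
  have hlim0 : Tendsto (fun n => s (n + 1) 0 0) atTop (𝓝 1) := by
    simp only [h00]; simpa using hlim.const_sub 1
  have hc0 : Tendsto (fun n => s (n + 1) 1 0) atTop (𝓝 0) := by
    have h1 : Tendsto (fun n => s n 1 0 * h) atTop (𝓝 0) :=
      squeeze_zero_norm hc ((tendsto_add_atTop_iff_nat 1).mpr
        (tendsto_pow_atTop_nhds_zero_of_lt_one hq0 hgh))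
    have h2 := (h1.pow 2).const_mul (-h⁻¹)
    simp only [h10]
    convert h2 using 2
    · field_simp
    · simp
  have hs_lim : Tendsto (fun n => s (n + 1 + 1)) atTop (𝓝 (upperUnipotent h)) := by
    rw [tendsto_specialLinearGroup_iff]
    have h1 := (tendsto_add_atTop_iff_nat 1).mpr hlim
    intro i j
    fin_cases i <;> fin_cases j
    · exact (tendsto_add_atTop_iff_nat 1).mpr hlim0
    · simp only [Fin.mk_one, Fin.zero_eta, h01 (_ + 1)]
      simpa using (hlim0.pow 2).mul_const h
    · exact (tendsto_add_atTop_iff_nat 1).mpr hc0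
    · simp only [Fin.mk_one, h11 (_ + 1)]
      simpa using h1.const_add 1
  have hev : ∀ᶠ n in atTop, s (n + 1 + 1) = upperUnipotent h := by
    have h1 : Tendsto (fun n => (⟨s (n + 1 + 1), hmem _⟩ : Λ)) atTop
        (𝓝 ⟨upperUnipotent h, hT⟩) := tendsto_subtype_rng.mpr hs_lim
    rw [nhds_discrete, tendsto_pure] at h1
    filter_upwards [h1] with n hn using congrArg Subtype.val hn
  obtain ⟨n, hn⟩ := hev.exists
  have hn0 : s (n + 1 + 1) 1 0 = 0 := by rw [hn]; rfl
  -- Since `c_(m+1) = -c_m² h` with `h ≠ 0`, vanishing propagates back to `g`.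
  have hback : ∀ m, s m 1 0 = 0 → s 0 1 0 = 0 := fun m => by
    induction m with
    | zero => exact id
    | succ m ih =>
      intro h1
      rw [h10] at h1
      exact ih (by simpa [hh] using h1)
  exact hback _ hn0

/-- The real numbers `x` with `(1 x; 0 1) ∈ Λ`. -/
def unipotentPeriods (Λ : Subgroup SL(2, ℝ)) : AddSubgroup ℝ where
  carrier := {x | upperUnipotent x ∈ Λ}
  zero_mem' := by
    have : upperUnipotent 0 = 1 := by ext i j; fin_cases i <;> fin_cases j <;> rfl
    simp only [Set.mem_ofPred_eq, this, one_mem]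
  add_mem' {a b} ha hb := by
    have : upperUnipotent (a + b) = upperUnipotent a * upperUnipotent b := by
      ext i j; fin_cases i <;> fin_cases j <;> simp [add_comm]
    simp only [Set.mem_ofPred_eq, this]
    exact mul_mem ha hb
  neg_mem' {a} ha := by
    have : upperUnipotent (-a) = (upperUnipotent a)⁻¹ := by
      ext i j; fin_cases i <;> fin_cases j <;> simp [Matrix.adjugate_fin_two]
    simp only [Set.mem_ofPred_eq, this]
    exact inv_mem ha

theorem mem_unipotentPeriods {Λ : Subgroup SL(2, ℝ)} {x : ℝ} :
    x ∈ unipotentPeriods Λ ↔ upperUnipotent x ∈ Λ := Iff.rfl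

instance (Λ : Subgroup SL(2, ℝ)) [DiscreteTopology Λ] : DiscreteTopology (unipotentPeriods Λ) := by
  refine DiscreteTopology.of_continuous_injective
    (f := fun x : unipotentPeriods Λ => (⟨upperUnipotent x, x.2⟩ : Λ)) ?_ ?_
  · refine Continuous.subtype_mk ?_ _
    refine continuous_induced_rng.mpr ?_
    refine continuous_matrix fun i j => ?_
    fin_cases i <;> fin_cases j <;> simp <;> fun_prop
  · intro x y hxy
    have := congrArg (fun g : Λ => (g : SL(2, ℝ)) 0 1) hxy
    exact Subtype.ext (by simpa using this)

theorem coe_upperUnipotent_smul (x : ℝ) (z : ℍ) :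
    ((upperUnipotent x • z : ℍ) : ℂ) = z + x := by
  rw [coe_specialLinearGroup_apply]
  simp

/-- `Im (g z) = Im z / |cz + d|²` and `|cz + d| ≥ |c| Im z`. So `c` is small when `z` and `g z` are
both high, as Shimizu's lemma requires. -/
theorem sq_mul_im_mul_im_le_one (g : SL(2, ℝ)) (z : ℍ) :
    g 1 0 ^ 2 * (z.im * (g • z).im) ≤ 1 := by
  have h1 := c_mul_im_sq_le_normSq_denom (g : GL (Fin 2) ℝ) z
  have h2 := im_smul_eq_div_normSq (g : GL (Fin 2) ℝ) z
  have h3 := normSq_denom_pos (g : GL (Fin 2) ℝ) z.im_ne_zero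
  have h4 : (g • z).im = ((g : GL (Fin 2) ℝ) • z).im := rfl
  have h5 : (g : GL (Fin 2) ℝ) 1 0 = g 1 0 := rfl
  rw [h4, h2]
  simp only [Matrix.SpecialLinearGroup.coeToGL_det, Units.val_one, abs_one, one_mul]
  rw [← mul_assoc, mul_div_assoc', div_le_one h3]
  calc _ = (g 1 0 * z.im) ^ 2 := by ring
    _ ≤ _ := h1

/-- Conjugation by an upper triangular `g` multiplies the period lattice by `a²`, so `a²` is an
integer; `g⁻¹` shows the same for `d²`, and `ad = 1` forces `a² = 1`. -/
theorem eq_or_eq_neg_upperUnipotent {Λ : Subgroup SL(2, ℝ)} [DiscreteTopology Λ] {h₀ : ℝ}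
    (hh₀ : h₀ ≠ 0) (hP : unipotentPeriods Λ = AddSubgroup.zmultiples h₀) {g : SL(2, ℝ)}
    (hg : g ∈ Λ) (hc : g 1 0 = 0) : ∃ b, g = upperUnipotent b ∨ g = -upperUnipotent b := by
  have hdet := Matrix.det_fin_two g.1
  rw [g.2, hc, mul_zero, sub_zero] at hdet
  have key : ∀ g ∈ Λ, g 1 0 = 0 → ∃ m : ℤ, g 0 0 ^ 2 = m := by
    intro g hg hc
    have h1 : g 0 0 ^ 2 * h₀ ∈ unipotentPeriods Λ := by
      have e : upperUnipotent (g 0 0 ^ 2 * h₀) = g * upperUnipotent h₀ * g⁻¹ := by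
        apply Subtype.ext
        rw [conj_upperUnipotent, hc]
        simp
      rw [mem_unipotentPeriods, e]
      refine mul_mem (mul_mem hg ?_) (inv_mem hg)
      rw [← mem_unipotentPeriods, hP]
      exact AddSubgroup.mem_zmultiples h₀
    rw [hP] at h1
    obtain ⟨m, hm⟩ := AddSubgroup.mem_zmultiples_iff.mp h1
    refine ⟨m, ?_⟩
    rw [zsmul_eq_mul] at hm
    exact (mul_right_cancel₀ hh₀ hm).symm
  obtain ⟨m, hm⟩ := key g hg hc
  obtain ⟨m', hm'⟩ := key g⁻¹ (inv_mem hg) (by simp [Matrix.adjugate_fin_two, hc])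
  have e11 : (g⁻¹ : SL(2, ℝ)) 0 0 = g 1 1 := by simp [Matrix.adjugate_fin_two]
  rw [e11] at hm'
  have hmm : m * m' = 1 := by
    have : (m : ℝ) * m' = 1 := by rw [← hm, ← hm', ← mul_pow, ← hdet, one_pow]
    exact_mod_cast this
  have hm1 : m = 1 := by
    rcases Int.eq_one_or_neg_one_of_mul_eq_one hmm with h | h
    · exact h
    · rw [h] at hm
      push_cast at hm
      nlinarith [sq_nonneg (g 0 0)]
  rw [hm1, Int.cast_one] at hm
  rcases mul_self_eq_one_iff.mp ((sq _).symm.trans hm) with h | h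
  · rw [h, one_mul] at hdet
    refine ⟨g 0 1, .inl ?_⟩
    ext i j
    fin_cases i <;> fin_cases j <;> simp [h, hc, ← hdet]
  · have hd : g 1 1 = -1 := by rw [h] at hdet; linarith
    refine ⟨-g 0 1, .inr ?_⟩
    ext i j
    fin_cases i <;> fin_cases j <;> simp [h, hc, hd]

/-- If a discrete group contains a translation, then its orbits meet the disc about `w` of radius
`Im w / 2` at most `O(Im w)` times. -/
theorem exists_encard_halfDisc_le {Λ : Subgroup SL(2, ℝ)} [DiscreteTopology Λ]
    (hneg : ∀ g ∈ Λ, -g ∈ Λ) {h : ℝ} (hh : h ≠ 0) (hT : upperUnipotent h ∈ Λ) :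
    ∃ C Y : ℝ, 0 < Y ∧ ∀ w : ℍ, Y ≤ w.im → ∀ z : ℍ,
      (({g : SL(2, ℝ) | g ∈ Λ ∧ g • z ∈ halfDisc w}.encard : ENat) : ENNReal) ≤
        ENNReal.ofReal (C * w.im) := by
  obtain ⟨h₀, hP⟩ := (unipotentPeriods Λ).isAddCyclic_iff_exists_zmultiples_eq_top.mp
    (AddSubgroup.discrete_iff_addCyclic.mpr inferInstance)
  have hh₀ : h₀ ≠ 0 := by
    rintro rfl
    have : h ∈ unipotentPeriods Λ := hT
    rw [← hP] at this
    simp [hh] at this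
  have hab : 0 < |h₀| := abs_pos.mpr hh₀
  -- Height above `2|h|` keeps the disc above `|h|`, so Shimizu's lemma applies. There remain `2(2M
  -- + 1)` elements with `M ≤ Im w / |h₀|`, and `Im w ≥ 1` absorbs the constant `2`.
  refine ⟨4 / |h₀| + 2, max 1 (2 * |h| + 1), by positivity, fun w hw z => ?_⟩
  have hw1 : 1 ≤ w.im := (le_max_left _ _).trans hw
  have hw2 : 2 * |h| + 1 ≤ w.im := (le_max_right _ _).trans hw
  set M : ℤ := ⌊w.im / |h₀|⌋
  have hM0 : 0 ≤ M := Int.floor_nonneg.mpr (by positivity)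
  set S : Set SL(2, ℝ) := (fun n : ℤ => upperUnipotent (n * h₀)) '' (Finset.Icc (-M) M : Finset ℤ) ∪
    (fun n : ℤ => -upperUnipotent (n * h₀)) '' (Finset.Icc (-M) M : Finset ℤ)
  have hS : S.encard ≤ ((2 * (2 * M + 1)).toNat : ℕ) := by
    refine (Set.encard_union_le _ _).trans ?_
    refine (add_le_add (Set.encard_image_le _ _) (Set.encard_image_le _ _)).trans ?_
    rw [Set.encard_coe_eq_coe_finsetCard, Int.card_Icc]
    norm_cast
    omega
  have hsub : {g : SL(2, ℝ) | g ∈ Λ ∧ g • z ∈ halfDisc w}.encard ≤ S.encard := by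
    rcases Set.eq_empty_or_nonempty {g : SL(2, ℝ) | g ∈ Λ ∧ g • z ∈ halfDisc w} with h | ⟨g₀, h₀Λ, h₀w⟩
    · simp [h]
    rw [← (mul_left_injective g₀⁻¹).encard_image {g : SL(2, ℝ) | g ∈ Λ ∧ g • z ∈ halfDisc w}]
    refine Set.encard_le_encard ?_
    rintro _ ⟨g, ⟨hg, hgw⟩, rfl⟩
    set u := g₀ • z
    have hε : g * g₀⁻¹ ∈ Λ := mul_mem hg (inv_mem h₀Λ)
    have hεu : (g * g₀⁻¹) • u ∈ halfDisc w := by simpa [u, mul_smul] using hgw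
    simp only
    generalize g * g₀⁻¹ = ε at hε hεu
    have hu1 := abs_lt.mp (abs_im_sub_lt_of_mem_halfDisc h₀w)
    have hu2 := abs_lt.mp (abs_im_sub_lt_of_mem_halfDisc hεu)
    have hc : ε 1 0 = 0 := by
      refine eq_zero_of_abs_mul_lt_one hh hT hε ?_
      have h1 := sq_mul_im_mul_im_le_one ε u
      have h2 : |h| ^ 2 < u.im * (ε • u).im := by
        rw [sq]
        have := abs_nonneg h
        apply mul_lt_mul'' <;> linarith
      rw [← sq_lt_one_iff_abs_lt_one, mul_pow, ← sq_abs h]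
      rcases eq_or_ne (ε 1 0) 0 with h0 | h0
      · simp [h0]
      · exact (mul_lt_mul_of_pos_left h2 (by positivity)).trans_le h1
    have hb : ∀ b, upperUnipotent b ∈ Λ → upperUnipotent b • u ∈ halfDisc w →
        ∃ n : ℤ, n ∈ Finset.Icc (-M) M ∧ upperUnipotent (n * h₀) = upperUnipotent b := by
      intro b hb hbw
      have h1 : b ∈ unipotentPeriods Λ := hb
      rw [← hP] at h1
      obtain ⟨n, hn⟩ := AddSubgroup.mem_zmultiples_iff.mp h1
      rw [zsmul_eq_mul] at hn
      refine ⟨n, ?_, by rw [hn]⟩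
      have h2 := abs_lt.mp (abs_re_sub_lt_of_mem_halfDisc h₀w)
      have h3 := abs_lt.mp (abs_re_sub_lt_of_mem_halfDisc hbw)
      have h4 : (upperUnipotent b • u).re = u.re + b := by
        have := congrArg Complex.re (coe_upperUnipotent_smul b u)
        simpa using this
      rw [h4] at h3
      have h5 : |b| ≤ w.im := abs_le.mpr ⟨by linarith, by linarith⟩
      rw [← hn, abs_mul, ← le_div_iff₀ hab] at h5
      have h6 : |n| ≤ M := Int.le_floor.mpr (by push_cast; exact h5)
      rw [Finset.mem_Icc]
      exact abs_le.mp h6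
    obtain ⟨b, hb' | hb'⟩ := eq_or_eq_neg_upperUnipotent hh₀ hP.symm hε hc
    · obtain ⟨n, hn, hn'⟩ := hb b (hb' ▸ hε) (hb' ▸ hεu)
      exact .inl ⟨n, hn, by rw [hb', ← hn']⟩
    · have e : upperUnipotent b • u = ε • u := by
        rw [← psl_mk_smul, ← psl_mk_smul, hb', psl_mk_neg]
      obtain ⟨n, hn, hn'⟩ := hb b (by simpa [hb'] using hneg _ hε) (e ▸ hεu)
      exact .inr ⟨n, hn, by rw [hb', ← hn']⟩
  have h1 := hsub.trans hS
  have h2 : (({g : SL(2, ℝ) | g ∈ Λ ∧ g • z ∈ halfDisc w}.encard : ENat) : ENNReal) ≤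
      ((2 * (2 * M + 1)).toNat : ENNReal) := by exact_mod_cast ENat.toENNReal_le.mpr h1
  refine h2.trans ?_
  rw [← ENNReal.ofReal_natCast]
  apply ENNReal.ofReal_le_ofReal
  have h3 : (((2 * (2 * M + 1)).toNat : ℕ) : ℝ) = 2 * (2 * M + 1) := by
    have : (((2 * (2 * M + 1)).toNat : ℕ) : ℤ) = 2 * (2 * M + 1) := Int.toNat_of_nonneg (by omega)
    exact_mod_cast this
  have h4 : (M : ℝ) ≤ w.im / |h₀| := Int.floor_le _
  rw [h3]
  calc 2 * (2 * (M : ℝ) + 1) ≤ 4 * (w.im / |h₀|) + 2 * 1 := by linarith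
    _ ≤ 4 * (w.im / |h₀|) + 2 * w.im := by linarith
    _ = _ := by ring

/-! ### Invariance of the size and hyperbolic radius of the discs -/

theorem petNorm_slash (k : ℤ) (f : ℍ → ℂ) (g : SL(2, ℝ)) (z : ℍ) :
    petNorm k (f ∣[k] (g : GL (Fin 2) ℝ)) z = petNorm k f (g • z) := by
  have h2 := im_smul_eq_div_normSq (g : GL (Fin 2) ℝ) z
  have h3 := norm_pos_iff.mpr (denom_ne_zero (g : GL (Fin 2) ℝ) z)
  have h4 : g • z = (g : GL (Fin 2) ℝ) • z := rfl
  have hz := z.im_pos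
  rw [petNorm, petNorm, h4, h2, ModularForm.slash_def]
  simp only [Matrix.SpecialLinearGroup.coeToGL_det, Units.val_one, abs_one, one_mul, norm_mul,
    norm_σ, Complex.normSq_eq_norm_sq]
  congr 1
  rw [Real.div_rpow hz.le (by positivity), ← Real.rpow_natCast, ← Real.rpow_mul h3.le]
  push_cast
  rw [mul_div_cancel₀ _ (two_ne_zero), Real.rpow_intCast, norm_zpow, zpow_neg]
  simp
  field_simp

theorem petNorm_pslSlash {k : ℤ} (hk : Even k) (f : ℍ → ℂ) (γ : PSL(2, ℝ)) (z : ℍ) :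
    petNorm k (pslSlash k f γ) z = petNorm k f (γ • z) := by
  obtain ⟨g, rfl⟩ := QuotientGroup.mk_surjective γ
  rw [pslSlash_mk hk, petNorm_slash, psl_mk_smul]

theorem petNorm_eq_enorm_mul (k : ℤ) (f : ℍ → ℂ) (z : ℍ) :
    petNorm k f z = ‖f z‖ₑ * ENNReal.ofReal (z.im ^ ((k : ℝ) / 2)) := by
  rw [petNorm, ENNReal.ofReal_mul (norm_nonneg _), ofReal_norm]

theorem mdifferentiable_slash {k : ℤ} {f : ℍ → ℂ} (hf : MDifferentiable 𝓘(ℂ) 𝓘(ℂ) f)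
    (g : SL(2, ℝ)) : MDifferentiable 𝓘(ℂ) 𝓘(ℂ) (f ∣[k] (g : GL (Fin 2) ℝ)) := by
  have := hf.slash k (g : GL (Fin 2) ℝ)
  exact this

/-- The discs have bounded hyperbolic radius, so those centred in a compact set stay in a larger
compact set. -/
theorem dist_le_of_mem_halfDisc {z u : ℍ} (h : u ∈ halfDisc z) :
    dist u z ≤ 2 * Real.arsinh (1 / 2) := by
  rw [UpperHalfPlane.dist_eq]
  refine mul_le_mul_of_nonneg_left (Real.arsinh_le_arsinh.mpr ?_) zero_le_two
  have hz := z.im_pos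
  have h1 := abs_lt.mp (abs_im_sub_lt_of_mem_halfDisc h)
  have h2 : z.im / 2 ≤ √(u.im * z.im) := by
    refine Real.le_sqrt_of_sq_le ?_
    nlinarith
  have h3 : dist (u : ℂ) z < z.im / 2 := h
  rw [div_le_div_iff₀ (by linarith) (by norm_num)]
  linarith

/-! ### Convergence, holomorphy and invariance of the series -/

section

variable {Γ Γ₀ : Subgroup PSL(2, ℝ)} {k : ℤ} {φ : ℍ → ℂ}

theorem mdifferentiable_relPoincareTerm (hφ : MDifferentiable 𝓘(ℂ) 𝓘(ℂ) φ) (q : RightCosets Γ₀ Γ) :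
    MDifferentiable 𝓘(ℂ) 𝓘(ℂ) (relPoincareTerm k φ Γ₀ Γ q) :=
  mdifferentiable_slash hφ _

theorem tsum_setLIntegral_relPoincareTerm_le [DiscreteTopology Γ] (hΓ₀ : Γ₀ ≤ Γ) (hk : Even k)
    (hφ : MDifferentiable 𝓘(ℂ) 𝓘(ℂ) φ) (hinv : ∀ γ ∈ Γ₀, pslSlash k φ γ = φ)
    {D : Set ℍ} (hD : IsFundamentalDomain Γ₀ D (volume : Measure ℍ))
    {A : Set ℍ} (hA : MeasurableSet A) {N : ENNReal}
    (hN : ∀ z, (({γ : PSL(2, ℝ) | γ ∈ Γ ∧ γ • z ∈ A}.encard : ENat) : ENNReal) ≤ N) :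
    ∑' q : RightCosets Γ₀ Γ, ∫⁻ z in A, petNorm k (relPoincareTerm k φ Γ₀ Γ q) z ≤
      N * ∫⁻ z in D, petNorm k φ z := by
  have := psl_countable_of_discrete Γ
  have : Countable Γ₀ := (Subgroup.inclusion_injective hΓ₀).countable
  simp only [relPoincareTerm, petNorm_pslSlash hk]
  refine tsum_setLIntegral_smul_le hΓ₀ hD (measurable_petNorm hφ.continuous) ?_ hA hN
  intro γ hγ z
  rw [← petNorm_pslSlash hk, hinv γ hγ]

/-- No convergence is assumed: a divergent series has the default value `0`. -/
theorem petNorm_relPoincare_le (z : ℍ) :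
    petNorm k (relPoincare k φ Γ₀ Γ) z ≤
      ∑' q : RightCosets Γ₀ Γ, petNorm k (relPoincareTerm k φ Γ₀ Γ q) z := by
  simp only [petNorm_eq_enorm_mul]
  rw [ENNReal.tsum_mul_right]
  gcongr
  exact enorm_tsum_le_tsum_enorm

/-- The terms of the relative Poincaré series are dominated by a summable sequence on every
compact set. -/
theorem exists_summable_bound [DiscreteTopology Γ] (hΓ₀ : Γ₀ ≤ Γ) (hk : Even k) (hk0 : 0 ≤ k)
    (hφ : MDifferentiable 𝓘(ℂ) 𝓘(ℂ) φ) (hinv : ∀ γ ∈ Γ₀, pslSlash k φ γ = φ)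
    {D : Set ℍ} (hD : IsFundamentalDomain Γ₀ D (volume : Measure ℍ))
    (hint : ∫⁻ z in D, petNorm k φ z < ⊤) {K : Set ℍ} (hK : IsCompact K) :
    ∃ u : RightCosets Γ₀ Γ → ℝ, Summable u ∧
      ∀ q, ∀ z ∈ K, ‖relPoincareTerm k φ Γ₀ Γ q z‖ ≤ u q := by
  rcases K.eq_empty_or_nonempty with rfl | hKne
  · exact ⟨0, summable_zero, by simp⟩
  -- The least height on `K` lets the factor `y^(k/2)` be divided out uniformly.
  obtain ⟨z₀, -, hz₀⟩ := hK.exists_isMinOn hKne continuous_im.continuousOn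
  obtain ⟨r, hr⟩ := hK.isBounded.subset_closedBall I
  set K' := Metric.closedBall I (r + 2 * Real.arsinh (1 / 2))
  have hK' : IsCompact K' := isCompact_closedBall _ _
  have hdisc : ∀ z ∈ K, halfDisc z ⊆ K' := fun z hz u hu => by
    have h1 := Metric.mem_closedBall.mp (hr hz)
    have h2 := dist_le_of_mem_halfDisc hu
    have h3 := dist_triangle u z I
    exact Metric.mem_closedBall.mpr (by linarith)
  obtain ⟨N, hN⟩ := exists_encard_le_of_isCompact (conjLift Γ 1) hK'
  have hsum := tsum_setLIntegral_relPoincareTerm_le hΓ₀ hk hφ hinv hD hK'.measurableSet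
    (N := (N : ENNReal)) (fun z => by
      have h1 := (encard_psl_le_encard_conjLift Γ 1 K' z).trans (hN _)
      simp only [inv_one, one_smul, Set.preimage_id'] at h1
      exact_mod_cast ENat.toENNReal_le.mpr h1)
  have hfin : ∑' q : RightCosets Γ₀ Γ, ∫⁻ z in K', petNorm k (relPoincareTerm k φ Γ₀ Γ q) z ≠ ⊤ :=
    (hsum.trans_lt (ENNReal.mul_lt_top (by simp) hint)).ne
  set C := 9 / Real.pi * 2 ^ ((k : ℝ) / 2)
  have hC : 0 ≤ C := by positivity
  have hm := z₀.im_pos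
  refine ⟨fun q => (C / z₀.im ^ ((k : ℝ) / 2)) *
    (∫⁻ z in K', petNorm k (relPoincareTerm k φ Γ₀ Γ q) z).toReal,
    (ENNReal.summable_toReal hfin).mul_left _, fun q z hz => ?_⟩
  have h1 : petNorm k (relPoincareTerm k φ Γ₀ Γ q) z ≤ ENNReal.ofReal C *
      ∫⁻ u in K', petNorm k (relPoincareTerm k φ Γ₀ Γ q) u :=
    (petNorm_le_setLIntegral_halfDisc hk0 (mdifferentiable_relPoincareTerm hφ q) z).trans
      (by gcongr; exact hdisc z hz)
  have hq := ENNReal.ne_top_of_tsum_ne_top hfin q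
  have h2 := ENNReal.toReal_mono (ENNReal.mul_ne_top ENNReal.ofReal_ne_top hq) h1
  rw [petNorm, ENNReal.toReal_mul, ENNReal.toReal_ofReal hC, ENNReal.toReal_ofReal
    (mul_nonneg (norm_nonneg _) (Real.rpow_nonneg z.im_pos.le _))] at h2
  simp only
  rw [div_mul_eq_mul_div, le_div_iff₀ (by positivity)]
  refine le_trans ?_ h2
  gcongr
  exact hz₀ hz

theorem mdifferentiable_relPoincare
    (hbound : ∀ K : Set ℍ, IsCompact K → ∃ u : RightCosets Γ₀ Γ → ℝ, Summable u ∧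
      ∀ q, ∀ z ∈ K, ‖relPoincareTerm k φ Γ₀ Γ q z‖ ≤ u q)
    (hφ : MDifferentiable 𝓘(ℂ) 𝓘(ℂ) φ) :
    MDifferentiable 𝓘(ℂ) 𝓘(ℂ) (relPoincare k φ Γ₀ Γ) := by
  intro z
  rw [mdifferentiableAt_iff]
  obtain ⟨u, hu, hle⟩ := hbound _ (isCompact_closedBall z 1)
  have hU : IsOpen (UpperHalfPlane.coe '' Metric.ball z 1) :=
    isOpenEmbedding_coe.isOpenMap _ Metric.isOpen_ball
  refine (Complex.differentiableOn_tsum_of_summable_norm (U := UpperHalfPlane.coe '' Metric.ball z 1) (u := u)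
    (F := fun q => relPoincareTerm k φ Γ₀ Γ q ∘ ofComplex) hu (fun q => ?_) hU ?_).differentiableAt
    (hU.mem_nhds ⟨z, Metric.mem_ball_self one_pos, rfl⟩)
  · refine (UpperHalfPlane.mdifferentiable_iff.mp (mdifferentiable_relPoincareTerm hφ q)).mono ?_
    rintro _ ⟨w, -, rfl⟩
    exact w.im_pos
  · rintro q _ ⟨w, hw, rfl⟩
    simpa using hle q w (Metric.ball_subset_closedBall hw)

theorem pslSlash_relPoincare (hk : Even k) (hinv : ∀ γ ∈ Γ₀, pslSlash k φ γ = φ) {γ : PSL(2, ℝ)}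
    (hγ : γ ∈ Γ) : pslSlash k (relPoincare k φ Γ₀ Γ) γ = relPoincare k φ Γ₀ Γ := by
  let e : RightCosets Γ₀ Γ ≃ RightCosets Γ₀ Γ :=
    Quotient.congr (Equiv.mulRight (⟨γ, hγ⟩ : Γ)) fun a b => by
      change QuotientGroup.rightRel _ a b ↔ QuotientGroup.rightRel _ _ _
      simp [QuotientGroup.rightRel_apply, mul_assoc]
  have he : ∀ q, relPoincareTerm k φ Γ₀ Γ (e q) = pslSlash k (relPoincareTerm k φ Γ₀ Γ q) γ := by
    intro q
    obtain ⟨a, rfl⟩ := Quotient.exists_rep q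
    have h1 : e (Quotient.mk _ a) = Quotient.mk _ (a * ⟨γ, hγ⟩) := rfl
    rw [h1, relPoincareTerm_mk (Γ := Γ) hk hinv (a * ⟨γ, hγ⟩), relPoincareTerm_mk hk hinv a,
      ← pslSlash_mul hk]
    rfl
  obtain ⟨g, rfl⟩ := QuotientGroup.mk_surjective γ
  ext z
  rw [pslSlash_mk_apply hk, relPoincare, relPoincare, ← tsum_div_const,
    ← e.tsum_eq fun q => relPoincareTerm k φ Γ₀ Γ q z]
  refine tsum_congr fun q => ?_
  rw [he, pslSlash_mk_apply hk]

/-! ### Behaviour at the cusps -/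

/-- A parabolic element fixing `c`, conjugated by `σ`, is upper triangular with equal diagonal
entries `±1`. The lift contains `-g` with `g`, and inversion makes the translation positive. -/
theorem exists_upperUnipotent_mem_conjLift {c : OnePoint ℝ} (hc : IsCusp c (matrixLift Γ))
    {σ : SL(2, ℝ)} (hσ : (σ : GL (Fin 2) ℝ) • OnePoint.infty = c) :
    ∃ x : ℝ, 0 < x ∧ upperUnipotent x ∈ conjLift Γ σ := by
  obtain ⟨_, ⟨g, hg, rfl⟩, hpar, hfix⟩ := hc
  have hg : (g : PSL(2, ℝ)) ∈ Γ := hg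
  set δ := σ⁻¹ * g * σ with hδ
  have hδΓ : δ ∈ conjLift Γ σ := by
    rw [mem_conjLift, hδ, show σ * (σ⁻¹ * g * σ) * σ⁻¹ = g by group]
    exact hg
  have hcoe : (δ : GL (Fin 2) ℝ) = (σ : GL (Fin 2) ℝ)⁻¹ * (g : GL (Fin 2) ℝ) * σ := by
    simp [hδ]
  have hδpar : (δ : GL (Fin 2) ℝ).IsParabolic := by
    rw [hcoe, Matrix.GeneralLinearGroup.isParabolic_conj_iff']
    exact hpar
  have hδfix : (δ : GL (Fin 2) ℝ) • (OnePoint.infty : OnePoint ℝ) = OnePoint.infty := by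
    rw [hcoe, mul_smul, mul_smul, hσ, inv_smul_eq_iff, hσ]
    exact hfix
  have h10 : δ 1 0 = 0 := OnePoint.smul_infty_eq_self_iff.mp hδfix
  obtain ⟨h1, h2⟩ := (Matrix.GeneralLinearGroup.isParabolic_iff_of_upperTriangular h10).mp hδpar
  have h1 : δ 0 0 = δ 1 1 := h1
  have h2 : δ 0 1 ≠ 0 := h2
  have hdet := Matrix.det_fin_two δ.1
  rw [δ.2, h10, mul_zero, sub_zero, h1] at hdet
  have key : ∃ x : ℝ, x ≠ 0 ∧ upperUnipotent x ∈ conjLift Γ σ := by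
    rcases mul_self_eq_one_iff.mp hdet.symm with h | h
    · refine ⟨δ 0 1, h2, ?_⟩
      convert hδΓ
      ext i j
      fin_cases i <;> fin_cases j <;> simp [h1, h10, h]
    · refine ⟨-δ 0 1, neg_ne_zero.mpr h2, ?_⟩
      convert neg_mem_conjLift hδΓ
      ext i j
      fin_cases i <;> fin_cases j <;> simp [h1, h10, h]
  obtain ⟨x, hx, hxΓ⟩ := key
  rcases hx.lt_or_gt with h | h
  · refine ⟨-x, by linarith, ?_⟩
    exact (unipotentPeriods (conjLift Γ σ)).neg_mem hxΓ
  · exact ⟨x, h, hxΓ⟩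

theorem isZeroAtImInfty_relPoincare_slash [DiscreteTopology Γ] (hΓ₀ : Γ₀ ≤ Γ) (hk : Even k)
    (hk4 : 4 ≤ k) (hφ : MDifferentiable 𝓘(ℂ) 𝓘(ℂ) φ) (hinv : ∀ γ ∈ Γ₀, pslSlash k φ γ = φ)
    {D : Set ℍ} (hD : IsFundamentalDomain Γ₀ D (volume : Measure ℍ))
    (hint : ∫⁻ z in D, petNorm k φ z < ⊤) {σ : SL(2, ℝ)} {x : ℝ} (hx : x ≠ 0)
    (hT : upperUnipotent x ∈ conjLift Γ σ) :
    IsZeroAtImInfty (relPoincare k φ Γ₀ Γ ∣[k] (σ : GL (Fin 2) ℝ)) := by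
  obtain ⟨C, Y, hY, hCY⟩ := exists_encard_halfDisc_le (fun g hg => neg_mem_conjLift hg) hx hT
  set J := (∫⁻ z in D, petNorm k φ z).toReal
  set C₀ := 9 / Real.pi * 2 ^ ((k : ℝ) / 2)
  have hC₀ : 0 ≤ C₀ := by positivity
  have hbd : ∀ w : ℍ, Y ≤ w.im → petNorm k (relPoincare k φ Γ₀ Γ ∣[k] (σ : GL (Fin 2) ℝ)) w ≤
      ENNReal.ofReal C₀ * (ENNReal.ofReal (|C| * w.im) * ENNReal.ofReal J) := by
    intro w hw
    rw [petNorm_slash]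
    refine (petNorm_relPoincare_le _).trans ?_
    have hmp : MeasurePreserving (σ • · : ℍ → ℍ) volume volume :=
      measurePreserving_smul ((σ : SL(2, ℝ)) : PSL(2, ℝ)) (volume : Measure ℍ)
    have hA : MeasurableSet ((σ⁻¹ • · : ℍ → ℍ) ⁻¹' halfDisc w) :=
      ((isOpen_halfDisc w).preimage (continuous_const_smul σ⁻¹)).measurableSet
    have hterm : ∀ q : RightCosets Γ₀ Γ, petNorm k (relPoincareTerm k φ Γ₀ Γ q) (σ • w) ≤
        ENNReal.ofReal C₀ * ∫⁻ u in (σ⁻¹ • · : ℍ → ℍ) ⁻¹' halfDisc w,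
          petNorm k (relPoincareTerm k φ Γ₀ Γ q) u := by
      intro q
      have hq := mdifferentiable_relPoincareTerm (k := k) hφ q
      rw [← petNorm_slash]
      refine (petNorm_le_setLIntegral_halfDisc (by omega) (mdifferentiable_slash hq σ) w).trans
        (le_of_eq ?_)
      congr 1
      simp only [petNorm_slash]
      rw [← hmp.setLIntegral_comp_preimage hA (measurable_petNorm hq.continuous)]
      congr 2
      ext u
      simp
    refine (ENNReal.tsum_le_tsum hterm).trans ?_
    rw [ENNReal.tsum_mul_left]
    gcongr
    rw [ENNReal.ofReal_toReal hint.ne]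
    refine tsum_setLIntegral_relPoincareTerm_le hΓ₀ hk hφ hinv hD hA fun z => ?_
    refine (ENat.toENNReal_le.mpr (encard_psl_le_encard_conjLift Γ σ _ z)).trans ?_
    refine (hCY w hw _).trans (ENNReal.ofReal_le_ofReal ?_)
    have := w.im_pos
    gcongr
    exact le_abs_self C
  have hbd' : ∀ w : ℍ, max Y 1 ≤ w.im →
      ‖(relPoincare k φ Γ₀ Γ ∣[k] (σ : GL (Fin 2) ℝ)) w‖ ≤ (C₀ * |C| * J) / w.im := by
    intro w hw
    have hw0 := w.im_pos
    have hJ : 0 ≤ J := ENNReal.toReal_nonneg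
    have h1 := hbd w ((le_max_left _ _).trans hw)
    have hw1 : 1 ≤ w.im := (le_max_right _ _).trans hw
    rw [petNorm, ← ENNReal.ofReal_mul (by positivity), ← ENNReal.ofReal_mul hC₀,
      ENNReal.ofReal_le_ofReal_iff (by positivity)] at h1
    -- Here `k ≥ 4` enters: `y²` outweighs the factor `y` from the orbit count and leaves `O(1/y)`.
    have h2 : w.im ^ 2 ≤ w.im ^ ((k : ℝ) / 2) := by
      rw [← Real.rpow_natCast]
      refine Real.rpow_le_rpow_of_exponent_le hw1 ?_
      have : (4 : ℝ) ≤ k := by exact_mod_cast hk4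
      push_cast
      linarith
    rw [le_div_iff₀ hw0]
    refine le_of_mul_le_mul_right ?_ hw0
    calc _ = ‖(relPoincare k φ Γ₀ Γ ∣[k] (σ : GL (Fin 2) ℝ)) w‖ * w.im ^ 2 := by ring
      _ ≤ _ := mul_le_mul_of_nonneg_left h2 (norm_nonneg _)
      _ ≤ _ := h1
      _ = _ := by ring
  have hlim : Tendsto (fun w : ℍ => (C₀ * |C| * J) / w.im) atImInfty (𝓝 0) :=
    tendsto_const_nhds.div_atTop tendsto_comap
  refine squeeze_zero_norm' ?_ hlim
  exact (atImInfty_mem _).mpr ⟨max Y 1, hbd'⟩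

theorem slash_relPoincare_periodic (hk : Even k) (hinv : ∀ γ ∈ Γ₀, pslSlash k φ γ = φ)
    {σ : SL(2, ℝ)} {x : ℝ} (hT : upperUnipotent x ∈ conjLift Γ σ) :
    Function.Periodic ((relPoincare k φ Γ₀ Γ ∣[k] (σ : GL (Fin 2) ℝ)) ∘ ofComplex) x := by
  set f := relPoincare k φ Γ₀ Γ
  have h1 : pslSlash k (pslSlash k f σ) (upperUnipotent x) = pslSlash k f σ := by
    have h2 := pslSlash_relPoincare (φ := φ) (Γ₀ := Γ₀) hk hinv (mem_conjLift.mp hT)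
    rw [← pslSlash_mul hk, ← QuotientGroup.mk_mul]
    nth_rw 2 [show f = pslSlash k f _ from h2.symm]
    rw [← pslSlash_mul hk, ← QuotientGroup.mk_mul, inv_mul_cancel_right]
  rw [← pslSlash_mk hk]
  intro w
  rcases lt_or_ge 0 w.im with hw | hw
  · have hw' : 0 < (w + x).im := by simpa using hw
    have h3 := congrFun h1 ⟨w, hw⟩
    rw [pslSlash_mk_apply hk] at h3
    simp only [Function.comp_apply, ofComplex_apply_of_im_pos hw, ofComplex_apply_of_im_pos hw']
    rw [← h3]
    simp
    congr 1
    ext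
    rw [coe_upperUnipotent_smul]
  -- Off the upper half plane `ofComplex` has a constant default value.
  · have hw' : (w + x).im ≤ 0 := by simpa using hw
    simp only [Function.comp_apply, ofComplex_apply_of_im_nonpos hw,
      ofComplex_apply_of_im_nonpos hw']

end

end

/-! ### The theorem -/

/-- `𝓕` is a fundamental domain for `Γ \ ℍ` and `D` one for `Γ₀ \ ℍ`, so that the integrals over
`Γ \ ℍ` and `Γ₀ \ ℍ` are integrals over `𝓕` and `D`; `volume` on `ℍ` is `dx dy / y ^ 2`. -/
theorem theorem1 (Γ Γ₀ : Subgroup PSL(2, ℝ)) [DiscreteTopology Γ] (hΓ₀ : Γ₀ ≤ Γ)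
    (𝓕 : Set ℍ) (h𝓕 : IsFundamentalDomain Γ 𝓕 (volume : Measure ℍ))
    (hvol : (volume : Measure ℍ) 𝓕 < ⊤)
    (k : ℤ) (hk : Even k) (hk4 : 4 ≤ k)
    (φ : ℍ → ℂ) (hφ : MDifferentiable 𝓘(ℂ) 𝓘(ℂ) φ)
    (hinv : ∀ γ ∈ Γ₀, pslSlash k φ γ = φ)
    (D : Set ℍ) (hD : IsFundamentalDomain Γ₀ D (volume : Measure ℍ))
    (hint : ∫⁻ z in D, ENNReal.ofReal (‖φ z‖ * z.im ^ ((k : ℝ) / 2)) < ⊤) :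
    (∀ z : ℍ, Summable fun q : RightCosets Γ₀ Γ => ‖relPoincareTerm k φ Γ₀ Γ q z‖) ∧
    (∀ K : Set ℍ, IsCompact K →
      SummableUniformlyOn (fun q z => ‖relPoincareTerm k φ Γ₀ Γ q z‖) K ∧
      HasSumUniformlyOn (relPoincareTerm k φ Γ₀ Γ) (relPoincare k φ Γ₀ Γ) K) ∧
    (∃ F : CuspForm (matrixLift Γ) k, (F : ℍ → ℂ) = relPoincare k φ Γ₀ Γ) ∧
    (∀ c : OnePoint ℝ, IsCusp c (matrixLift Γ) →
      DecaysRapidlyAt k (relPoincare k φ Γ₀ Γ) c) := by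
  have hint' : ∫⁻ z in D, petNorm k φ z < ⊤ := hint
  have hbound := fun (K : Set ℍ) (hK : IsCompact K) =>
    exists_summable_bound hΓ₀ hk (by omega) hφ hinv hD hint' hK
  have hdiff := mdifferentiable_relPoincare hbound hφ
  have hzero : ∀ σ : SL(2, ℝ), IsCusp ((σ : GL (Fin 2) ℝ) • OnePoint.infty) (matrixLift Γ) →
      ∃ x : ℝ, 0 < x ∧ upperUnipotent x ∈ conjLift Γ σ ∧
        IsZeroAtImInfty (relPoincare k φ Γ₀ Γ ∣[k] (σ : GL (Fin 2) ℝ)) := by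
    intro σ hσ
    obtain ⟨x, hx, hxΓ⟩ := exists_upperUnipotent_mem_conjLift hσ rfl
    exact ⟨x, hx, hxΓ,
      isZeroAtImInfty_relPoincare_slash hΓ₀ hk hk4 hφ hinv hD hint' hx.ne' hxΓ⟩
  refine ⟨fun z => ?_, fun K hK => ?_, ⟨⟨⟨relPoincare k φ Γ₀ Γ, ?_⟩, hdiff, ?_⟩, rfl⟩, ?_⟩
  · obtain ⟨u, hu, hle⟩ := hbound {z} isCompact_singleton
    exact Summable.of_nonneg_of_le (fun _ => norm_nonneg _) (fun q => hle q z rfl) hu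
  · obtain ⟨u, hu, hle⟩ := hbound K hK
    refine ⟨(HasSumUniformlyOn.of_norm_le_summable hu fun q z hz => ?_).summableUniformlyOn,
      HasSumUniformlyOn.of_norm_le_summable hu hle⟩
    rw [norm_norm]
    exact hle q z hz
  · rintro _ ⟨g, hg, rfl⟩
    exact (pslSlash_mk hk _ g).symm.trans (pslSlash_relPoincare hk hinv hg)
  · intro c hc
    obtain ⟨σ, hσ⟩ := c.exists_mem_SL2 ℝ
    have hσ : (σ : GL (Fin 2) ℝ) • OnePoint.infty = c := by
      rw [← hσ]
      congr 1
    obtain ⟨-, -, -, h0⟩ := hzero σ (hσ ▸ hc)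
    exact (OnePoint.isZeroAt_iff hσ).mpr h0
  · intro c hc σ hσ
    obtain ⟨x, hx, hxΓ, h0⟩ := hzero σ (hσ ▸ hc)
    -- Period `x` gives an expansion in `exp(2πiz/x)` without constant term; `exp(-2πy/x)` is the
    -- absolute value of this variable.
    refine ⟨2 * Real.pi / x, by positivity, ?_⟩
    have h1 := h0.exp_decay_atImInfty hx (slash_relPoincare_periodic hk hinv hxΓ)
      (mdifferentiable_slash hdiff σ) h0.isBoundedAtImInfty
    convert h1 using 3 with z
    ring
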